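/- **Setting and terminology.** Let $\mathcal U$ be a Euclidean space (a finite-dimensional real inner product space), give $\mathcal U\times\mathcal U$ the Euclidean product structure, and let $\Phi:\mathcal U\rightrightarrows\mathcal U$ be a set-valued mapping with graph $\operatorname{gph}\Phi=\{(u,v): v\in\Phi(u)\}$. A set $X$ in a Euclidean space $E$ is a $C^{(r)}$-manifold around $z\in X$ if, near $z$, $X$ is the zero set of a $C^{(r)}$-smooth map from a neighborhood of $z$ to some $\mathbb R^m$ with surjective derivative at $z$. Let $T_X(x)$ denote the (Bouligand) tangent cone and $N_X(x)$ the limiting normal cone, and set $$z\in D\Phi(u|v)(w)\iff (w,z)\in T_{\operatorname{gph}\Phi}(u,v),\qquad z\in D^*\Phi(u|v)(y)\iff (z,-y)\in N_{\operatorname{gph}\Phi}(u,v).$$ For a set $A$, $\operatorname{Proj}_A(x)$ denotes the set of nearest points of $A$ to $x$, identified with its element when it is a singleton. The mapping $\Phi$ is *$C^{(r)}$-partly smooth at $\bar u$ for $\bar v\in\Phi(\bar u)$* if $\operatorname{gph}\Phi$ is a $C^{(r)}$-manifold around $(\bar u,\bar v)$ and the map $(u,v)\mapsto u$ on $\operatorname{gph}\Phi$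 has constant rank near $(\bar u,\bar v)$. Its *active manifold* at $\bar u$ for $\bar v$ is the (locally unique) set $\mathcal M\subset\mathcal U$ such that, for every sufficiently small neighborhood $V$ of $(\bar u,\bar v)$, $\mathcal M$ coincides near $\bar u$ with $\{u:\exists v,\ (u,v)\in V\cap\operatorname{gph}\Phi\}$. **Theorem (Active set method for generalized equations).** Let $\bar u$ be an isolated zero of $\Phi$ (that is, $0\in\Phi(\bar u)$, and $0\notin\Phi(u)$ for all $u\ne\bar u$ near $\bar u$). Suppose that $\Phi$ is $C^{(2)}$-partly smooth at $\bar u$ for $0$, with active manifold $\mathcal M$, and that $$0\in D^*\Phi(\bar u|0)(y)\ \Rightarrow\ y=0.$$ Then for every sufficiently small neighborhood $W$ of $\bar u$ the following hold. 1. There exists a Lipschitz map $S:W\to\mathcal M$ with $S(\bar u)=\bar u$. In particular, for every $u\in W$ the set $\operatorname{Proj}_{\mathcal M}(u)$ is a singleton, and $S=\operatorname{Proj}_{\mathcal M}$ is such a map. 2. There exists a Lipschitz map $Q:\mathcal M\cap W\to\mathcal U$ with $Q(\bar u)=0$ and $Q(u)\in\Phi(u)$ for all $u\in\mathcal M\cap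 W$. In particular, for every $u\in\mathcal M\cap W$ the set $\operatorname{Proj}_{\Phi(u)}(0)$ is a singleton, and $Q(u)=\operatorname{Proj}_{\Phi(u)}(0)$ defines such a map. 3. For all $(u,v)\in\operatorname{gph}\Phi$ near $(\bar u,0)$, the linearized equation $$-v\in D\Phi(u|v)(w-u),\qquad w\in W,$$ has a unique solution $w=w(u,v)$. Furthermore, let $S$ and $Q$ be any maps with the properties in the first sentences of 1 and 2. Then there is a constant $C$ such that, starting from any point $(u_0,v_0)\in\operatorname{gph}\Phi$ sufficiently near $(\bar u,0)$, the iteration $$u_{k+1}=S\big(w(u_k,v_k)\big),\qquad v_{k+1}=Q(u_{k+1})$$ is well defined, remains in $\operatorname{gph}\Phi$, and converges quadratically to $(\bar u,0)$: $(u_k,v_k)\to(\bar u,0)$ and $$\big\|(u_{k+1},v_{k+1})-(\bar u,0)\big\|\le C\,\big\|(u_k,v_k)-(\bar u,0)\big\|^2\quad\text{for all }k\ge 0.$$ -/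

import Mathlib

open Set Filter Topology
open scoped NNReal

namespace ActiveSet

section General

variable {E : Type*} [NormedAddCommGroup E] [InnerProductSpace ℝ E]

/-- `X` is a `C^r` manifold around `z ∈ X` (`r = 1, 2, 3, …`): near `z` it is the zero set of a
`C^r` map into some `ℝᵐ` whose derivative at `z` is surjective. -/
def IsManifoldAround (r : ℕ) (X : Set E) (z : E) : Prop :=
  z ∈ X ∧ ∃ (m : ℕ) (F : E → EuclideanSpace ℝ (Fin m)),
    ContDiffAt ℝ r F z ∧ Function.Surjective (fderiv ℝ F z) ∧ ∀ᶠ x in 𝓝 z, x ∈ X ↔ F x = 0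

/-- The (Bouligand) tangent cone `T_X(x)`: limits of `c n • (y n - x)` with `y n ∈ X`, `y n → x`
and `c n ≥ 0`. It is the classical tangent space when `X` is a manifold around `x`. -/
abbrev tangentCone (X : Set E) (x : E) : Set E := posTangentConeAt X x

/-- The regular (Fréchet) normal cone: `⟪v, y - x⟫ ≤ o(‖y - x‖)` as `y → x` in `X`. -/
def regularNormalCone (X : Set E) (x : E) : Set E :=
  {v | x ∈ X ∧ ∀ ε : ℝ, 0 < ε → ∀ᶠ y in 𝓝[X] x, inner ℝ v (y - x) ≤ ε * ‖y - x‖}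

/-- The limiting normal cone `N_X(x)`: limits of regular normals at points of `X` tending to `x`.
It is the classical normal space when `X` is a manifold around `x`. -/
def limitingNormalCone (X : Set E) (x : E) : Set E :=
  {v | x ∈ X ∧ ∃ (xs vs : ℕ → E), (∀ n, vs n ∈ regularNormalCone X (xs n)) ∧
    Tendsto xs atTop (𝓝 x) ∧ Tendsto vs atTop (𝓝 v)}

/-- The set of nearest points `Proj_A(x)`. -/
def proj (A : Set E) (x : E) : Set E :=
  {p | p ∈ A ∧ ∀ q ∈ A, dist x p ≤ dist x q}

/-- Quadratic convergence of `x` to `z`, with constant `C`. -/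
def ConvergesQuadratically (C : ℝ) (x : ℕ → E) (z : E) : Prop :=
  Tendsto x atTop (𝓝 z) ∧ ∀ k, ‖x (k + 1) - z‖ ≤ C * ‖x k - z‖ ^ 2

end General

section SetValued

variable {U : Type*} [NormedAddCommGroup U] [InnerProductSpace ℝ U]

/-- The pair `(u, v)` as a point of the Euclidean product `U²`. -/
abbrev pair (u v : U) : WithLp 2 (U × U) := WithLp.toLp 2 (u, v)

/-- The graph of a set-valued mapping, in the Euclidean product `U²`. -/
def gph (Φ : U → Set U) : Set (WithLp 2 (U × U)) :=
  {p | p.snd ∈ Φ p.fst}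

/-- The graphical derivative `DΦ(u|v)(w) = {z | (w, z) ∈ T_{gph Φ}(u, v)}`. -/
def graphicalDeriv (Φ : U → Set U) (u v w : U) : Set U :=
  {z | pair w z ∈ tangentCone (gph Φ) (pair u v)}

/-- The coderivative `D*Φ(u|v)(y) = {z | (z, -y) ∈ N_{gph Φ}(u, v)}`. -/
def coderiv (Φ : U → Set U) (u v y : U) : Set U :=
  {z | pair z (-y) ∈ limitingNormalCone (gph Φ) (pair u v)}

/-- `u` is an isolated zero of `Φ`. -/
def IsIsolatedZero (Φ : U → Set U) (u : U) : Prop :=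
  0 ∈ Φ u ∧ ∀ᶠ u' in 𝓝[≠] u, 0 ∉ Φ u'

/-- The rank at `p` of the projection `(u, v) ↦ u` restricted to `gph Φ`: the dimension of the
image of the tangent space to the graph. -/
noncomputable def projRank (Φ : U → Set U) (p : WithLp 2 (U × U)) : ℕ :=
  Module.finrank ℝ (Submodule.span ℝ
    ((fun q : WithLp 2 (U × U) => q.fst) '' tangentCone (gph Φ) p))

/-- `Φ` is `C^r`-partly smooth at `u` for `v`: the graph is a `C^r` manifold around `(u, v)`, and
the projection `(u, v) ↦ u` on the graph has constant rank near `(u, v)`. -/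
def IsPartlySmooth (r : ℕ) (Φ : U → Set U) (u v : U) : Prop :=
  IsManifoldAround r (gph Φ) (pair u v) ∧
    ∃ d : ℕ, ∀ᶠ p in 𝓝[gph Φ] (pair u v), projRank Φ p = d

/-- `M` is the active manifold at `u` for `v`: for all small neighborhoods `V` of `(u, v)`, it
coincides near `u` with the image of `gph Φ ∩ V` under `(u, v) ↦ u`. -/
def IsActiveManifold (Φ : U → Set U) (u v : U) (M : Set U) : Prop :=
  ∃ V₀ ∈ 𝓝 (pair u v), ∀ V ∈ 𝓝 (pair u v), V ⊆ V₀ →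
    ∀ᶠ u' in 𝓝 u, u' ∈ M ↔ ∃ v', pair u' v' ∈ gph Φ ∩ V

/-- `S : W → M` is Lipschitz and fixes `u`. -/
def IsPrimalMap (M W : Set U) (u : U) (S : U → U) : Prop :=
  MapsTo S W M ∧ (∃ K : ℝ≥0, LipschitzOnWith K S W) ∧ S u = u

/-- `Q : M ∩ W → U` is a Lipschitz selection of `Φ` with `Q(u) = 0`. -/
def IsDualMap (Φ : U → Set U) (M W : Set U) (u : U) (Q : U → U) : Prop :=
  (∀ x ∈ M ∩ W, Q x ∈ Φ x) ∧ (∃ K : ℝ≥0, LipschitzOnWith K Q (M ∩ W)) ∧ Q u = 0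

/-- The solutions `w ∈ W` of the linearized equation `-v ∈ DΦ(u|v)(w - u)` at `p = (u, v)`. -/
def linearizedSolutions (Φ : U → Set U) (W : Set U) (p : WithLp 2 (U × U)) : Set U :=
  {w | w ∈ W ∧ -p.snd ∈ graphicalDeriv Φ p.fst p.snd (w - p.fst)}

/-- `x` is a sequence in `gph Φ` generated by `u ← S(w(u, v))`, `v ← Q(u)`, where every step is
well defined: `w(u, v)` is the unique solution in `W` of the linearized equation, and `S(w(u, v))`
lies in the domain `M ∩ W` of `Q`. -/
def IsActiveSetSequence (Φ : U → Set U) (M W : Set U) (S Q : U → U)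
    (x : ℕ → WithLp 2 (U × U)) : Prop :=
  ∀ k, x k ∈ gph Φ ∧ ∃ w, linearizedSolutions Φ W (x k) = {w} ∧ S w ∈ M ∩ W ∧
    x (k + 1) = pair (S w) (Q (S w))

end SetValued

end ActiveSet

/-!
Transversality and isolation reduce the whole problem to a single smooth map. The coderivative
condition says that no nonzero normal to the graph of `Φ` at `(ū, 0)` is orthogonal to `U × {0}`.
So, for a submersion `F` defining the graph, `∂F/∂u` is onto. The set `{u | F (u, 0) = 0}` is the
single point `ū` near `ū`, so `∂F/∂u` is also one-to-one. By the implicit function theorem the graph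
is, near `(ū, 0)`, the set of all `(h v, v)` for a `C²` map `h` with `h 0 = ū`
(`exists_inverse_graph`).

The tangent space to the graph at `(h v, v)` consists of the `(Dh(v) z, z)`, so that the linearized
equation has the single solution `w = h v - Dh(v) v`. Taylor's formula gives `w - ū = O(‖v‖²)`
(`exists_norm_sub_fderiv_apply_le`). Lipschitz maps `S` and `Q` with `S ū = ū` and `Q ū = 0`
preserve this estimate, which is quadratic convergence (`exists_quadratic_convergence`).

The special choices of `S` and `Q` use partial smoothness, that is, the constancy of the rank of
`Dh`. By the constant rank theorem (`exists_constant_rank_chart`) there are `C²` maps `ψ` and `β`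
with `h (ψ (r, k)) = β r`, where `ψ` is a local chart. The active manifold is then the image of `β`,
and near `0` the set `Φ (β r)` is the image of `ψ (r, ·)`. Both projections are therefore minimizers
of `‖ψ (a, ·)‖` for a `C²` map `ψ` of a parameter `a`, with a zero at the base point and a
one-to-one partial derivative there. Such minimizers exist locally, are unique, and are Lipschitz in
`a` (`exists_lipschitz_minimizer`): half the squared norm has, at the base point, the positive
definite second derivative `‖∂ψ k‖²` in the second variable.
-/

namespace ActiveSet

/-! ### Normals and isolated points of fibres -/

section General

variable {E G : Type*} [NormedAddCommGroup E] [InnerProductSpace ℝ E]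
  [NormedAddCommGroup G] [InnerProductSpace ℝ G]

theorem regularNormalCone_subset_limitingNormalCone (X : Set E) (x : E) :
    regularNormalCone X x ⊆ limitingNormalCone X x := fun v h =>
  ⟨h.1, fun _ => x, fun _ => v, fun _ => h, tendsto_const_nhds, tendsto_const_nhds⟩

/-- Gradients of the equations defining a set are normal to it. -/
theorem adjoint_apply_mem_regularNormalCone [CompleteSpace E] [CompleteSpace G] {X : Set E}
    {F : E → G} {F' : E →L[ℝ] G} {x : E} (hx : x ∈ X) (hF : HasFDerivAt F F' x)
    (hX : ∀ᶠ y in 𝓝[X] x, F y = F x) (l : G) :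
    F'.adjoint l ∈ regularNormalCone X x := by
  refine ⟨hx, fun ε hε => ?_⟩
  have hc : 0 < ε / (‖l‖ + 1) := by positivity
  filter_upwards [hX, nhdsWithin_le_nhds (hF.isLittleO.def hc)] with y hy hy'
  rw [hy, sub_self, zero_sub, norm_neg] at hy'
  rw [ContinuousLinearMap.adjoint_inner_left]
  calc inner ℝ l (F' (y - x)) ≤ ‖l‖ * ‖F' (y - x)‖ := real_inner_le_norm _ _
    _ ≤ (‖l‖ + 1) * (ε / (‖l‖ + 1) * ‖y - x‖) := by gcongr; linarith
    _ = ε * ‖y - x‖ := by field_simp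

/-- A submersion with an isolated point in a fibre is a local diffeomorphism there: a nonzero
kernel vector would be the velocity of a curve in the fibre. -/
theorem fderiv_injective_of_isolated [FiniteDimensional ℝ G] [CompleteSpace E] {f : E → G}
    {f' : E →L[ℝ] G} {a : E} (hf : HasStrictFDerivAt f f' a) (hsurj : Function.Surjective f')
    (hiso : ∀ᶠ x in 𝓝[≠] a, f x ≠ f a) : Function.Injective f' := by
  have hr : f'.range = ⊤ := LinearMap.range_eq_top.2 hsurj
  rw [injective_iff_map_eq_zero]
  intro y hy
  by_contra hy0
  let k : f'.ker := ⟨y, hy⟩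
  let φ := hf.implicitFunction f f' hr (f a)
  have hφ : HasStrictFDerivAt φ f'.ker.subtypeL 0 := hf.to_implicitFunction hr
  have hφ0 : φ 0 = a := hf.implicitFunction_apply_image hr
  have hline : HasDerivAt (fun t : ℝ => t • k) k 0 := by
    simpa using (hasDerivAt_id (0 : ℝ)).smul_const k
  have hcurve : HasDerivAt (fun t : ℝ => φ (t • k)) y 0 := by
    have h0 : HasFDerivAt φ f'.ker.subtypeL ((0 : ℝ) • k) := by
      rw [zero_smul]; exact hφ.hasFDerivAt
    exact h0.comp_hasDerivAt (0 : ℝ) hline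
  have hne : ∀ᶠ t in 𝓝[≠] (0 : ℝ), φ (t • k) ≠ a := hcurve.eventually_ne hy0
  have hcont : Tendsto (fun t : ℝ => φ (t • k)) (𝓝[≠] 0) (𝓝 a) := by
    have := hcurve.continuousAt.tendsto
    rw [zero_smul, hφ0] at this
    exact this.mono_left nhdsWithin_le_nhds
  have hfib : ∀ᶠ t in 𝓝[≠] (0 : ℝ), f (φ (t • k)) = f a := by
    have h1 : Tendsto (fun t : ℝ => (f a, t • k)) (𝓝[≠] 0) (𝓝 (f a, 0)) := by
      refine tendsto_const_nhds.prodMk_nhds ?_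
      have := hline.continuousAt.tendsto
      rw [zero_smul] at this
      exact this.mono_left nhdsWithin_le_nhds
    exact h1.eventually (hf.map_implicitFunction_eq hr)
  have hiso' : ∀ᶠ t in 𝓝[≠] (0 : ℝ), f (φ (t • k)) ≠ f a :=
    (tendsto_nhdsWithin_iff.2 ⟨hcont, hne⟩).eventually hiso
  obtain ⟨t, h1, h2⟩ := (hfib.and hiso').exists
  exact h2 h1

end General

/-! ### The graph as the graph of an inverse map -/

section Graph

theorem continuous_pair {U : Type*} [NormedAddCommGroup U] :
    Continuous fun p : U × U => pair p.1 p.2 :=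
  WithLp.prod_continuous_toLp 2 U U

variable {U : Type*} [NormedAddCommGroup U] [InnerProductSpace ℝ U]

/-- Near `(u, 0)`, the graph is the graph of a `C²` map `h` in the reverse direction, from the
second factor to the first. The coderivative condition says that the graph is transversal to
`U × {0}`, so that the derivative in `u` of its defining equations is onto; as the intersection
with `U × {0}` is isolated, it is also one-to-one, and the equations can be solved for `u`. -/
theorem exists_inverse_graph [FiniteDimensional ℝ U] {Φ : U → Set U} {u : U}
    (hzero : IsIsolatedZero Φ u) (hman : IsManifoldAround 2 (gph Φ) (pair u 0))
    (htrans : ∀ y : U, 0 ∈ coderiv Φ u 0 y → y = 0) :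
    ∃ h : U → U, ContDiffAt ℝ 2 h 0 ∧ h 0 = u ∧
      ∀ᶠ p in 𝓝 (pair u 0), p ∈ gph Φ ↔ p.fst = h p.snd := by
  obtain ⟨hmem, m, F, hF, hsurj, hzs⟩ := hman
  have hcU : CompleteSpace U := FiniteDimensional.complete ℝ U
  set z := pair u (0 : U) with hz
  set F' := fderiv ℝ F z with hF'
  have hFz : F z = 0 := hzs.self_of_nhds.1 hmem
  -- the equations with the two factors exchanged, as a function on the plain product
  let L : U × U →L[ℝ] WithLp 2 (U × U) :=
    (WithLp.prodContinuousLinearEquiv 2 ℝ U U).symm.toContinuousLinearMap ∘L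
      (ContinuousLinearMap.snd ℝ U U).prod (ContinuousLinearMap.fst ℝ U U)
  have hL : ∀ p, L p = pair p.2 p.1 := fun p => rfl
  have hLz : L (0, u) = z := rfl
  let f : U × U → EuclideanSpace ℝ (Fin m) := fun p => F (L p)
  have hf : ContDiffAt ℝ 2 f (0, u) :=
    ContDiffAt.comp (0, u) (hLz ▸ hF) L.contDiff.contDiffAt
  have hFd : HasStrictFDerivAt F F' z := hF.hasStrictFDerivAt (by norm_num)
  have hf' : fderiv ℝ f (0, u) = F' ∘L L :=
    (HasFDerivAt.comp (0, u) (by rw [hLz]; exact hFd.hasFDerivAt) L.hasFDerivAt).fderiv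
  let T : U →L[ℝ] EuclideanSpace ℝ (Fin m) := fderiv ℝ f (0, u) ∘L .inr ℝ U U
  have hT : ∀ y, T y = F' (pair y 0) := fun y => by simp [T, hf', hL]
  have hTsurj : Function.Surjective T := by
    rw [← ContinuousLinearMap.coe_coe, ← LinearMap.range_eq_top,
      ← Submodule.orthogonal_eq_bot_iff, Submodule.eq_bot_iff]
    intro l hl
    have hl' : ∀ y, inner ℝ l (F' (pair y 0)) = 0 := fun y => by
      rw [real_inner_comm, ← hT]
      exact (Submodule.mem_orthogonal _ _).1 hl _ (LinearMap.mem_range_self _ y)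
    set n := F'.adjoint l with hn
    have hnormal : n ∈ limitingNormalCone (gph Φ) z := by
      refine regularNormalCone_subset_limitingNormalCone _ _
        (adjoint_apply_mem_regularNormalCone hmem hFd.hasFDerivAt ?_ l)
      filter_upwards [nhdsWithin_le_nhds hzs, self_mem_nhdsWithin] with y hy hyX
      rw [hy.1 hyX, hFz]
    have hn1 : n.fst = 0 := by
      have := hl' n.fst
      rw [← ContinuousLinearMap.adjoint_inner_left, ← hn] at this
      simpa using this
    have hn2 : n.snd = 0 := by
      have : (0 : U) ∈ coderiv Φ u 0 (-n.snd) := by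
        have e : pair (0 : U) (- -n.snd) = n := by
          rw [neg_neg, ← hn1]; rfl
        rw [coderiv, mem_ofPred, e]
        exact hnormal
      simpa using htrans _ this
    have hn0 : n = 0 := by
      have e : n = pair n.fst n.snd := rfl
      rw [e, hn1, hn2]; rfl
    obtain ⟨y, rfl⟩ := hsurj l
    have : inner ℝ (F' y) (F' y) = (0 : ℝ) := by
      rw [← ContinuousLinearMap.adjoint_inner_left, ← hn, hn0, inner_zero_left]
    exact inner_self_eq_zero.1 this
  have hTinj : Function.Injective T := by
    have hd : HasStrictFDerivAt (fun x => f (0, x)) T u := by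
      have h1 : HasStrictFDerivAt f (fderiv ℝ f (0, u)) ((fun x : U => ((0 : U), x)) u) :=
        hf.hasStrictFDerivAt (by norm_num)
      exact h1.comp u (ContinuousLinearMap.inr ℝ U U).hasStrictFDerivAt
    refine fderiv_injective_of_isolated hd hTsurj ?_
    have hc : Tendsto (fun x : U => pair x 0) (𝓝[≠] u) (𝓝 z) := by
      have : Continuous fun x : U => pair x (0 : U) :=
        continuous_pair.comp (continuous_id.prodMk continuous_const)
      exact (this.tendsto u).mono_left nhdsWithin_le_nhds
    filter_upwards [hzero.2, hc.eventually hzs] with x hx hx'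
    have e : f (0, u) = 0 := hFz
    rw [e]
    exact fun h0 => hx (hx'.2 h0)
  have hinv : (fderiv ℝ f (0, u) ∘L .inr ℝ U U).IsInvertible :=
    ⟨(LinearEquiv.ofBijective T.toLinearMap ⟨hTinj, hTsurj⟩).toContinuousLinearEquiv, by
      ext y; rfl⟩
  refine ⟨hf.implicitFunction two_ne_zero hinv,
    hf.contDiffAt_implicitFunction two_ne_zero hinv,
    hf.implicitFunction_apply_self two_ne_zero hinv, ?_⟩
  have hswap : Tendsto (fun p : WithLp 2 (U × U) => (p.snd, p.fst)) (𝓝 z) (𝓝 ((0 : U), u)) :=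
    (((WithLp.sndL 2 ℝ U U).continuous.prodMk (WithLp.fstL 2 ℝ U U).continuous).tendsto z)
  filter_upwards [hzs,
    hswap.eventually (hf.eventually_apply_eq_iff_implicitFunction two_ne_zero hinv)] with p hp hp'
  have e1 : f (p.snd, p.fst) = F p := rfl
  have e2 : f (0, u) = 0 := hFz
  rw [e1, e2] at hp'
  rw [hp, hp', eq_comm]

/-- The tangent space to the graph `{(h v, v)}` of a differentiable map. -/
theorem tangentCone_eq_of_inverse_graph {X : Set (WithLp 2 (U × U))} {h : U → U} {h' : U →L[ℝ] U}
    {p : WithLp 2 (U × U)} (hX : ∀ᶠ q in 𝓝 p, q ∈ X ↔ q.fst = h q.snd) (hp : p ∈ X)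
    (hh : HasFDerivAt h h' p.snd) :
    tangentCone X p = {q | q.fst = h' q.snd} := by
  have hp1 : p.fst = h p.snd := hX.self_of_nhds.1 hp
  ext q
  constructor
  · intro hq
    obtain ⟨α, l, hl, c, d, hd, hds, hcd⟩ := exists_fun_of_mem_tangentConeAt hq
    have hd' : Tendsto (fun n => p + d n) l (𝓝 p) := by simpa using hd.const_add p
    have hsnd : Tendsto (fun n => c n • (d n).snd) l (𝓝 q.snd) :=
      ((WithLp.sndL 2 ℝ U U).continuous.tendsto q).comp hcd
    have hfst : Tendsto (fun n => c n • (d n).fst) l (𝓝 q.fst) :=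
      ((WithLp.fstL 2 ℝ U U).continuous.tendsto q).comp hcd
    have hd2 : Tendsto (fun n => (d n).snd) l (𝓝 0) :=
      ((WithLp.sndL 2 ℝ U U).continuous.tendsto 0).comp hd
    have hlim : Tendsto (fun n => c n • (h (p.snd + (d n).snd) - h p.snd)) l (𝓝 (h' q.snd)) :=
      hh.hasFDerivWithinAt.lim (s := univ) (c := fun n => (c n : ℝ)) hd2
        (.of_forall fun _ => mem_univ _) hsnd
    refine tendsto_nhds_unique (hfst.congr' ?_) hlim
    filter_upwards [hds, hd'.eventually hX] with n hn hn'
    have := hn'.1 hn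
    simp only [WithLp.add_fst, WithLp.add_snd] at this
    rw [← this, ← hp1]
    simp
  · intro hq
    -- the curve `n ↦ (h (v + n⁻¹ • q.snd), v + n⁻¹ • q.snd)` in `X` has velocity `q`
    let e : ℕ → U := fun n => (n : ℝ)⁻¹ • q.snd
    let d : ℕ → WithLp 2 (U × U) := fun n => pair (h (p.snd + e n) - h p.snd) (e n)
    have he : Tendsto e atTop (𝓝 0) := by
      simpa using (tendsto_inv_atTop_zero.comp (tendsto_natCast_atTop_atTop (R := ℝ))).smul_const
        q.snd
    have hhe : Tendsto (fun n => h (p.snd + e n) - h p.snd) atTop (𝓝 0) := by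
      have h1 : Tendsto (fun n => p.snd + e n) atTop (𝓝 p.snd) := by simpa using he.const_add p.snd
      simpa using (hh.continuousAt.tendsto.comp h1).sub_const (h p.snd)
    have hd : Tendsto d atTop (𝓝 0) := (continuous_pair.tendsto (0, 0)).comp (hhe.prodMk_nhds he)
    have hd' : Tendsto (fun n => p + d n) atTop (𝓝 p) := by simpa using hd.const_add p
    refine mem_tangentConeAt_of_seq atTop (fun n : ℕ => (n : ℝ≥0)) d hd ?_ ?_
    · filter_upwards [hd'.eventually hX] with n hn
      rw [hn]
      simp [d, hp1]
    · have h1 : Tendsto (fun n : ℕ => (n : ℝ) • (h (p.snd + e n) - h p.snd)) atTop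
          (𝓝 q.fst) := by
        rw [show q.fst = h' q.snd from hq]
        refine hh.lim q.snd ?_
        simpa using tendsto_natCast_atTop_atTop (R := ℝ)
      have h2 : Tendsto (fun n : ℕ => (n : ℝ) • e n) atTop (𝓝 q.snd) := by
        refine tendsto_const_nhds.congr' ?_
        filter_upwards [eventually_ne_atTop 0] with n hn
        have : (n : ℝ) ≠ 0 := Nat.cast_ne_zero.2 hn
        simp [e, smul_smul, this]
      exact (continuous_pair.tendsto (q.fst, q.snd)).comp (h1.prodMk_nhds h2)

end Graph

/-! ### Maps of constant rank -/

/-- A map whose derivative vanishes in the second variable near `0` depends, near `0`, only on the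
first variable. -/
theorem eventually_eq_of_fderiv_inr_eq_zero {A B F : Type*} [NormedAddCommGroup A] [NormedSpace ℝ A]
    [NormedAddCommGroup B] [NormedSpace ℝ B] [NormedAddCommGroup F] [NormedSpace ℝ F]
    {H : A × B → F}
    (hH : ∀ᶠ q in 𝓝 0, DifferentiableAt ℝ H q)
    (h0 : ∀ᶠ q in 𝓝 0, ∀ k : B, fderiv ℝ H q (0, k) = 0) :
    ∀ᶠ q in 𝓝 0, H q = H (q.1, 0) := by
  obtain ⟨ε, hε, hball⟩ := Metric.eventually_nhds_iff_ball.1 (hH.and h0)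
  filter_upwards [Metric.ball_mem_nhds _ hε] with q hq
  have hq' : q.1 ∈ Metric.ball 0 ε ∧ q.2 ∈ Metric.ball 0 ε := by
    rwa [← Prod.mk_zero_zero, ← ball_prod_same, mem_prod] at hq
  have key := (convex_ball (0 : B) ε).norm_image_sub_le_of_norm_hasFDerivWithin_le
    (f := fun k => H (q.1, k)) (f' := fun k => fderiv ℝ H (q.1, k) ∘L .inr ℝ A B) (C := 0)
    (x := 0) (y := q.2) ?_ ?_ (Metric.mem_ball_self hε) hq'.2
  · rw [zero_mul, norm_le_zero_iff, sub_eq_zero] at key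
    exact key
  · intro k hk
    have hmem : (q.1, k) ∈ Metric.ball (0 : A × B) ε := by
      rw [← Prod.mk_zero_zero, ← ball_prod_same]; exact ⟨hq'.1, hk⟩
    exact ((hball _ hmem).1.hasFDerivAt.comp k (hasFDerivAt_prodMk_right q.1 k)).hasFDerivWithinAt
  · intro k hk
    have hmem : (q.1, k) ∈ Metric.ball (0 : A × B) ε := by
      rw [← Prod.mk_zero_zero, ← ball_prod_same]; exact ⟨hq'.1, hk⟩
    rw [norm_le_zero_iff]
    ext k'
    simpa using (hball _ hmem).2 k'

/-- Constant rank theorem. Let the rank of the derivative of `h` be constant near `a`, and take for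
`R` and `K` its range and its kernel at `a`. Then `v ↦ (P_R (h v - h a), P_K (v - a))` is a local
chart at `a`, with inverse `ψ`, in which `h` depends on the first coordinate only. Hence the image
of `h` is, locally, a graph over `R`, parametrized by `β`. -/
theorem exists_constant_rank_chart {E F : Type*} [NormedAddCommGroup E] [InnerProductSpace ℝ E]
    [FiniteDimensional ℝ E] [NormedAddCommGroup F] [InnerProductSpace ℝ F] [FiniteDimensional ℝ F]
    {n : WithTop ℕ∞} {h : E → F} {a : E} (hh : ContDiffAt ℝ n h a)
    (hn : 1 ≤ n) {d : ℕ}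
    (hrank : ∀ᶠ v in 𝓝 a, Module.finrank ℝ (fderiv ℝ h v).range = d) :
    ∃ (R : Submodule ℝ F) (K : Submodule ℝ E) (ψ : R × K → E) (β : R → F),
      ContDiffAt ℝ n ψ 0 ∧ ψ 0 = a ∧ ContDiffAt ℝ n β 0 ∧ β 0 = h a ∧
      (∀ᶠ q in 𝓝 0, h (ψ q) = β q.1) ∧
      (∀ᶠ r in 𝓝 0, R.orthogonalProjectionOnto (β r - h a) = r) ∧
      (∀ᶠ v in 𝓝 a,
        ψ (R.orthogonalProjectionOnto (h v - h a), K.orthogonalProjectionOnto (v - a)) = v) ∧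
      Function.Injective (fderiv ℝ ψ 0 ∘L .inr ℝ R K) := by
  have hn0 : n ≠ 0 := (lt_of_lt_of_le zero_lt_one hn).ne'
  have hcE : CompleteSpace E := FiniteDimensional.complete ℝ E
  set h' := fderiv ℝ h a
  let R : Submodule ℝ F := h'.range
  let K : Submodule ℝ E := h'.ker
  have hd : Module.finrank ℝ R = d := hrank.self_of_nhds
  have hha : HasFDerivAt h h' a := (hh.differentiableAt hn0).hasFDerivAt
  let PR : F →L[ℝ] R := R.orthogonalProjectionOnto
  let PK : E →L[ℝ] K := K.orthogonalProjectionOnto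
  let α : E → R × K := fun v => (PR (h v - h a), PK (v - a))
  let A : E →L[ℝ] R × K := (PR ∘L h').prod PK
  have hα : ContDiffAt ℝ n α a :=
    (PR.contDiff.contDiffAt.comp a (hh.sub contDiffAt_const)).prodMk
      (PK.contDiff.contDiffAt.comp a (contDiffAt_id.sub contDiffAt_const))
  have hαA : HasFDerivAt α A a :=
    (PR.hasFDerivAt.comp a (hha.sub_const _)).prodMk
      (PK.hasFDerivAt.comp a ((hasFDerivAt_id a).sub_const a))
  have hAinj : Function.Injective A := by
    rw [injective_iff_map_eq_zero]
    intro v hv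
    have h1 : PR (h' v) = 0 := congrArg Prod.fst hv
    have h2 : PK v = 0 := congrArg Prod.snd hv
    have h3 : h' v = 0 := by
      have e : PR (h' v) = ⟨h' v, LinearMap.mem_range_self _ v⟩ :=
        R.orthogonalProjectionOnto_mem_subspace_eq_self ⟨h' v, LinearMap.mem_range_self _ v⟩
      rw [e] at h1
      exact congrArg Subtype.val h1
    have e : PK v = ⟨v, h3⟩ := K.orthogonalProjectionOnto_mem_subspace_eq_self ⟨v, h3⟩
    rw [e] at h2
    exact congrArg Subtype.val h2
  have hfr : Module.finrank ℝ E = Module.finrank ℝ (R × K) := by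
    rw [Module.finrank_prod]
    exact (LinearMap.finrank_range_add_finrank_ker h'.toLinearMap).symm
  -- the derivative `A` of the chart `α` at `a` is invertible
  let e : E ≃L[ℝ] R × K :=
    (LinearEquiv.ofInjectiveOfFinrankEq A.toLinearMap hAinj hfr).toContinuousLinearEquiv
  have heA : (e : E →L[ℝ] R × K) = A := by ext1 v; rfl
  have hαe : HasFDerivAt α (e : E →L[ℝ] R × K) a := heA ▸ hαA
  have hαs : HasStrictFDerivAt α (e : E →L[ℝ] R × K) a := hα.hasStrictFDerivAt' hαe hn0
  have hα0 : α a = 0 := by simp [α]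
  let ψ := hα.localInverse hαe hn0
  have hψ : ContDiffAt ℝ n ψ 0 := hα0 ▸ hα.to_localInverse hαe hn0
  have hψ0 : ψ 0 = a := by
    have := hα.localInverse_apply_image hαe hn0
    rwa [hα0] at this
  have hψs : HasStrictFDerivAt ψ (e.symm : R × K →L[ℝ] E) 0 := hα0 ▸ hαs.to_localInverse
  have hleft : ∀ᶠ v in 𝓝 a, ψ (α v) = v := hαs.eventually_left_inverse
  have hright : ∀ᶠ q in 𝓝 0, α (ψ q) = q := hα0 ▸ hαs.eventually_right_inverse
  let H : R × K → F := h ∘ ψ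
  have hH : ContDiffAt ℝ n H 0 := ContDiffAt.comp 0 (by rw [hψ0]; exact hh) hψ
  have hψc : Tendsto ψ (𝓝 0) (𝓝 a) := by
    have := hψ.continuousAt.tendsto
    rwa [hψ0] at this
  have hdψ : ∀ᶠ q in 𝓝 0, DifferentiableAt ℝ ψ q :=
    ((hψ.of_le hn).eventually (by simp)).mono fun q hq => hq.differentiableAt one_ne_zero
  have hdh : ∀ᶠ q in 𝓝 0, DifferentiableAt ℝ h (ψ q) :=
    hψc.eventually <|
      ((hh.of_le hn).eventually (by simp)).mono fun q hq => hq.differentiableAt one_ne_zero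
  have hconst : ∀ᶠ q in 𝓝 0, H q = H (q.1, 0) := by
    refine eventually_eq_of_fderiv_inr_eq_zero ?_ ?_
    · filter_upwards [hdψ, hdh] with q h1 h2 using h2.comp q h1
    filter_upwards [hdψ, hdh, hright.eventually_nhds, hψc.eventually hrank] with q h1 h2 h3 h4 k
    have hc : HasFDerivAt H (fderiv ℝ h (ψ q) ∘L fderiv ℝ ψ q) q :=
      h2.hasFDerivAt.comp q h1.hasFDerivAt
    -- differentiating `P_R (H q - h a) = q.1`
    have hPR : ∀ w, PR (fderiv ℝ h (ψ q) (fderiv ℝ ψ q w)) = w.1 := by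
      have e1 : HasFDerivAt (fun q => PR (H q - h a))
          (PR ∘L (fderiv ℝ h (ψ q) ∘L fderiv ℝ ψ q)) q :=
        PR.hasFDerivAt.comp q (hc.sub_const _)
      have e2 : HasFDerivAt (fun q : R × K => PR (H q - h a)) (.fst ℝ R K) q :=
        hasFDerivAt_fst.congr_of_eventuallyEq (h3.mono fun q' hq' => congrArg Prod.fst hq')
      intro w
      exact DFunLike.congr_fun (e1.unique e2) w
    -- so `P_R` maps the range of `Dh` at `ψ q` onto `R`; by equality of ranks it is one-to-one
    let T : (fderiv ℝ h (ψ q)).range →ₗ[ℝ] R := PR.toLinearMap ∘ₗ Submodule.subtype _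
    have hTs : Function.Surjective T := fun r =>
      ⟨⟨_, LinearMap.mem_range_self _ (fderiv ℝ ψ q (r, 0))⟩, hPR (r, 0)⟩
    have hTi : Function.Injective T :=
      (LinearMap.injective_iff_surjective_of_finrank_eq_finrank (h4.trans hd.symm)).2 hTs
    rw [hc.fderiv]
    have : (⟨_, LinearMap.mem_range_self _ (fderiv ℝ ψ q (0, k))⟩ :
        (fderiv ℝ h (ψ q)).range) = 0 :=
      hTi ((hPR (0, k)).trans (map_zero T).symm)
    exact congrArg Subtype.val this
  have hinl : Tendsto (fun r : R => (r, (0 : K))) (𝓝 0) (𝓝 0) :=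
    (ContinuousLinearMap.inl ℝ R K).continuous.tendsto' 0 0 rfl
  refine ⟨R, K, ψ, fun r => H (r, 0), hψ, hψ0, ?_, ?_, hconst, ?_, hleft, ?_⟩
  · exact ContDiffAt.comp (g := H) (f := fun r : R => (r, (0 : K))) 0 hH
      (ContinuousLinearMap.inl ℝ R K).contDiff.contDiffAt
  · exact congrArg h hψ0
  · exact (hinl.eventually hright).mono fun r hr => congrArg Prod.fst hr
  · rw [hψs.hasFDerivAt.fderiv]
    exact e.symm.injective.comp (Prod.mk_right_injective 0)

/-! ### Parametrized nearest points -/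

section NearestPoint

variable {A B E : Type*} [NormedAddCommGroup A] [NormedSpace ℝ A]
  [NormedAddCommGroup B] [InnerProductSpace ℝ B]
  [NormedAddCommGroup E] [InnerProductSpace ℝ E]

/-- The derivative in the second variable of `‖ψ‖² / 2`. -/
noncomputable def halfSqGrad (ψ : A × B → E) (q : A × B) : B →L[ℝ] ℝ :=
  innerSL ℝ (ψ q) ∘L (fderiv ℝ ψ q ∘L .inr ℝ A B)

/-- At a zero of `ψ`, the second derivative of `ψ` does not enter the derivative of `halfSqGrad ψ`,
as it is multiplied by `ψ = 0`. -/
theorem exists_hasStrictFDerivAt_halfSqGrad {ψ : A × B → E} {q₀ : A × B}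
    (hψ : ContDiffAt ℝ 2 ψ q₀) (h0 : ψ q₀ = 0) :
    ∃ G' : A × B →L[ℝ] (B →L[ℝ] ℝ), HasStrictFDerivAt (halfSqGrad ψ) G' q₀ ∧
      ∀ w k, G' w k = inner ℝ (fderiv ℝ ψ q₀ w) (fderiv ℝ ψ q₀ (0, k)) := by
  have hψ1 : HasStrictFDerivAt ψ (fderiv ℝ ψ q₀) q₀ := hψ.hasStrictFDerivAt two_ne_zero
  have hd1 : ContDiffAt ℝ 1 (fun q => fderiv ℝ ψ q ∘L .inr ℝ A B) q₀ :=
    (hψ.fderiv_right (m := 1) (by norm_num [one_add_one_eq_two])).clm_comp contDiffAt_const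
  have hi : HasStrictFDerivAt (fun q => innerSL ℝ (ψ q))
      ((innerSL ℝ (E := E)) ∘L fderiv ℝ ψ q₀) q₀ :=
    (innerSL ℝ (E := E)).hasStrictFDerivAt.comp q₀ hψ1
  refine ⟨_, hi.clm_comp (hd1.hasStrictFDerivAt one_ne_zero), fun w k => ?_⟩
  simp only [h0, map_zero, ContinuousLinearMap.zero_comp, zero_add,
    ContinuousLinearMap.comp_apply,
    ContinuousLinearMap.flip_apply, ContinuousLinearMap.compL_apply,
    ContinuousLinearMap.inr_apply]
  exact innerSL_apply_apply ℝ _ _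

/-- Near a zero of `ψ` where the derivative in the second variable is one-to-one, the points where
`‖ψ (a, ·)‖²` is critical depend in a Lipschitz way on `a`; in particular there is at most one for
each `a`. -/
theorem exists_norm_sub_le_of_halfSqGrad_eq_zero {ψ : A × B → E} {q₀ : A × B} {c : ℝ}
    (hψ : ContDiffAt ℝ 2 ψ q₀) (h0 : ψ q₀ = 0) (hc : 0 < c)
    (hlow : ∀ k, c * ‖k‖ ≤ ‖fderiv ℝ ψ q₀ (0, k)‖) :
    ∃ C : ℝ≥0, ∃ V ∈ 𝓝 q₀, ∀ q ∈ V, ∀ q' ∈ V, halfSqGrad ψ q = 0 → halfSqGrad ψ q' = 0 →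
      ‖q.2 - q'.2‖ ≤ C * ‖q.1 - q'.1‖ := by
  set D := fderiv ℝ ψ q₀ with hD
  obtain ⟨G', hG', hG'a⟩ := exists_hasStrictFDerivAt_halfSqGrad hψ h0
  rw [← hD] at hG'a
  have hε : 0 < c ^ 2 / 2 := by positivity
  have hev := hG'.isLittleO.def hε
  rw [nhds_prod_eq] at hev
  obtain ⟨V, hV, hVV⟩ := eventually_prod_self_iff'.1 hev
  refine ⟨((‖D‖ ^ 2 + c ^ 2 / 2) / (c ^ 2 / 2)).toNNReal, V, hV, fun q hq q' hq' hg hg' => ?_⟩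
  rw [Real.coe_toNNReal _ (by positivity)]
  have hs : ‖halfSqGrad ψ q - halfSqGrad ψ q' - G' (q - q')‖ ≤ c ^ 2 / 2 * ‖q - q'‖ :=
    hVV q hq q' hq'
  rw [hg, hg', sub_self, zero_sub, norm_neg] at hs
  set x := q.1 - q'.1
  set y := q.2 - q'.2
  have hsplit : q - q' = (x, 0) + (0, y) := by simp [x, y, Prod.ext_iff]
  have hn : ‖q - q'‖ ≤ ‖x‖ + ‖y‖ := by
    rw [hsplit]
    refine (norm_add_le _ _).trans_eq ?_
    simp
  have h1 : G' (q - q') y ≤ c ^ 2 / 2 * (‖x‖ + ‖y‖) * ‖y‖ :=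
    calc G' (q - q') y ≤ ‖G' (q - q') y‖ := Real.le_norm_self _
      _ ≤ ‖G' (q - q')‖ * ‖y‖ := ContinuousLinearMap.le_opNorm _ _
      _ ≤ c ^ 2 / 2 * (‖x‖ + ‖y‖) * ‖y‖ := by gcongr; exact hs.trans (by gcongr)
  rw [hG'a, hsplit, map_add, inner_add_left, real_inner_self_eq_norm_sq] at h1
  -- expand `G' (x, y) y = ⟪D (x, 0), D (0, y)⟫ + ‖D (0, y)‖²` and bound it from below
  have h2 : (c * ‖y‖) ^ 2 ≤ ‖D (0, y)‖ ^ 2 := by gcongr; exact hlow y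
  have h3 : -(‖D‖ ^ 2 * ‖x‖ * ‖y‖) ≤ inner ℝ (D (x, 0)) (D (0, y)) := by
    refine neg_le_of_abs_le ((abs_real_inner_le_norm _ _).trans ?_)
    have e1 : ‖D (x, 0)‖ ≤ ‖D‖ * ‖x‖ := by simpa using D.le_opNorm (x, 0)
    have e2 : ‖D (0, y)‖ ≤ ‖D‖ * ‖y‖ := by simpa using D.le_opNorm (0, y)
    calc ‖D (x, 0)‖ * ‖D (0, y)‖ ≤ (‖D‖ * ‖x‖) * (‖D‖ * ‖y‖) := by gcongr
      _ = _ := by ring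
  change ‖y‖ ≤ (‖D‖ ^ 2 + c ^ 2 / 2) / (c ^ 2 / 2) * ‖x‖
  rcases (norm_nonneg y).eq_or_lt with hy | hy
  · rw [← hy]; positivity
  · rw [div_mul_eq_mul_div, le_div_iff₀ hε]
    refine le_of_mul_le_mul_right ?_ hy
    linarith [h1, h2, h3]

/-- A local minimum of `‖ψ (a, ·)‖` is critical for its square. -/
theorem halfSqGrad_eq_zero_of_isLocalMin {ψ : A × B → E} {a : A} {b : B}
    (hψ : DifferentiableAt ℝ ψ (a, b)) (hmin : IsLocalMin (fun b' => ‖ψ (a, b')‖) b) :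
    halfSqGrad ψ (a, b) = 0 := by
  have hd : HasFDerivAt (fun b' => ψ (a, b')) (fderiv ℝ ψ (a, b) ∘L .inr ℝ A B) b :=
    hψ.hasFDerivAt.comp b (hasFDerivAt_prodMk_right a b)
  have hmin' : IsLocalMin (fun b' => ‖ψ (a, b')‖ ^ 2) b :=
    hmin.mono fun b' hb' => by
      dsimp only at hb' ⊢
      gcongr
  have := hmin'.hasFDerivAt_eq_zero hd.norm_sq
  ext k
  have hk := DFunLike.congr_fun this k
  simpa [halfSqGrad] using hk

/-- Parametrized nearest points: if `ψ (a₀, b₀) = 0` and the derivative of `ψ` in the second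
variable is one-to-one, then for `a` near `a₀` the norm of `ψ (a, ·)` has a unique minimizer `b a`
near `b₀`, and `b` is Lipschitz. -/
theorem exists_lipschitz_minimizer [FiniteDimensional ℝ B] {ψ : A × B → E} {a₀ : A} {b₀ : B}
    (hψ : ContDiffAt ℝ 2 ψ (a₀, b₀)) (h0 : ψ (a₀, b₀) = 0)
    (hinj : Function.Injective (fderiv ℝ ψ (a₀, b₀) ∘L .inr ℝ A B)) :
    ∃ (b : A → B) (C : ℝ≥0), ∃ N ∈ 𝓝 a₀, ∃ δ > 0, LipschitzOnWith C b N ∧ b a₀ = b₀ ∧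
      ∀ a ∈ N, ∀ b' ∈ Metric.closedBall b₀ δ, b' ≠ b a → ‖ψ (a, b a)‖ < ‖ψ (a, b')‖ := by
  set D := fderiv ℝ ψ (a₀, b₀) with hD
  have hψ1 : HasStrictFDerivAt ψ D (a₀, b₀) := hψ.hasStrictFDerivAt two_ne_zero
  obtain ⟨c, hc, hlow⟩ : ∃ c > 0, ∀ k, c * ‖k‖ ≤ ‖D (0, k)‖ := by
    obtain ⟨κ, hκ, hanti⟩ :=
      (D ∘L .inr ℝ A B).toLinearMap.exists_antilipschitzWith (LinearMap.ker_eq_bot.2 hinj)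
    have hκ' : (0 : ℝ) < κ := hκ
    refine ⟨(κ : ℝ)⁻¹, by positivity, fun k => ?_⟩
    rw [inv_mul_le_iff₀ hκ']
    have := hanti.le_mul_dist k 0
    rw [map_zero, dist_zero_right, dist_zero_right] at this
    simpa using this
  obtain ⟨C, V, hV, hVC⟩ := exists_norm_sub_le_of_halfSqGrad_eq_zero hψ h0 hc hlow
  -- near `(a₀, b₀)`, the map `ψ (a, ·)` expands distances at least by `c / 2`
  have hexp : ∀ᶠ p in 𝓝 (((a₀, b₀), (a₀, b₀)) : (A × B) × (A × B)),
      ‖ψ p.1 - ψ p.2 - D (p.1 - p.2)‖ ≤ c / 2 * ‖p.1 - p.2‖ := hψ1.isLittleO.def (half_pos hc)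
  rw [nhds_prod_eq] at hexp
  obtain ⟨V', hV', hVV'⟩ := eventually_prod_self_iff'.1 hexp
  have hdiff : ∀ᶠ q in 𝓝 (a₀, b₀), DifferentiableAt ℝ ψ q :=
    (hψ.eventually (by simp)).mono fun q hq => hq.differentiableAt two_ne_zero
  obtain ⟨r, hr, hball⟩ := Metric.mem_nhds_iff.1 (inter_mem (inter_mem hV hV') hdiff)
  set δ := r / 2 with hδ
  have hδ0 : 0 < δ := half_pos hr
  have hmem : ∀ a ∈ Metric.ball a₀ r, ∀ b ∈ Metric.closedBall b₀ δ, (a, b) ∈ V ∩ V' ∩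
      {q | DifferentiableAt ℝ ψ q} := fun a ha b hb => by
    refine hball ?_
    rw [← ball_prod_same]
    exact ⟨ha, Metric.closedBall_subset_ball (half_lt_self hr) hb⟩
  have hb₀ : b₀ ∈ Metric.closedBall b₀ δ := Metric.mem_closedBall_self hδ0.le
  have hgrow : ∀ a ∈ Metric.ball a₀ r, ∀ b ∈ Metric.closedBall b₀ δ,
      c / 2 * ‖b - b₀‖ ≤ ‖ψ (a, b) - ψ (a, b₀)‖ := fun a ha b hb => by
    have h1 : ‖ψ (a, b) - ψ (a, b₀) - D ((a, b) - (a, b₀))‖ ≤ c / 2 * ‖(a, b) - (a, b₀)‖ :=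
      hVV' _ (hmem a ha b hb).1.2 _ (hmem a ha b₀ hb₀).1.2
    have e : (a, b) - (a, b₀) = (0, b - b₀) := by simp
    have en : ‖((0 : A), b - b₀)‖ = ‖b - b₀‖ := by simp
    rw [e, en] at h1
    have h2 := norm_sub_norm_le (D (0, b - b₀)) (ψ (a, b) - ψ (a, b₀))
    rw [norm_sub_rev (D _)] at h2
    linarith [hlow (b - b₀)]
  let N : Set A := Metric.ball a₀ r ∩ {a | ‖ψ (a, b₀)‖ < c * δ / 4}
  have hN : N ∈ 𝓝 a₀ := by
    refine inter_mem (Metric.ball_mem_nhds _ hr) ?_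
    have h1 : ContinuousAt (fun a => ‖ψ (a, b₀)‖) a₀ :=
      (ContinuousAt.comp (g := ψ) (f := fun a => (a, b₀)) hψ.continuousAt
        (Continuous.prodMk_left b₀).continuousAt).norm
    refine h1.eventually_lt continuousAt_const ?_
    simp only [h0, norm_zero]
    positivity
  -- points not worse than `b₀` are interior, so that minimizers are critical
  have hint : ∀ a ∈ N, ∀ b ∈ Metric.closedBall b₀ δ, ‖ψ (a, b)‖ ≤ ‖ψ (a, b₀)‖ →
      b ∈ Metric.ball b₀ δ := fun a ha b hb hle => by
    rw [mem_ball_iff_norm]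
    have h1 := hgrow a ha.1 b hb
    have h2 := norm_sub_le (ψ (a, b)) (ψ (a, b₀))
    have h3 : ‖ψ (a, b₀)‖ < c * δ / 4 := ha.2
    have : c * ‖b - b₀‖ < c * δ := by linarith
    exact lt_of_mul_lt_mul_left this hc.le
  have hcrit : ∀ a ∈ N, ∀ b ∈ Metric.closedBall b₀ δ,
      (∀ b' ∈ Metric.closedBall b₀ δ, ‖ψ (a, b)‖ ≤ ‖ψ (a, b')‖) → halfSqGrad ψ (a, b) = 0 := by
    intro a ha b hb hmin
    refine halfSqGrad_eq_zero_of_isLocalMin (hmem a ha.1 b hb).2 ?_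
    filter_upwards [Metric.isOpen_ball.mem_nhds (hint a ha b hb (hmin b₀ hb₀))] with b' hb'
    exact hmin b' (Metric.ball_subset_closedBall hb')
  have hex : ∀ a, ∃ b, a ∈ N → b ∈ Metric.closedBall b₀ δ ∧
      ∀ b' ∈ Metric.closedBall b₀ δ, ‖ψ (a, b)‖ ≤ ‖ψ (a, b')‖ := by
    intro a
    by_cases ha : a ∈ N
    · have hcont : ContinuousOn (fun b => ‖ψ (a, b)‖) (Metric.closedBall b₀ δ) := fun b hb =>
        (ContinuousAt.comp (g := ψ) (f := fun b => (a, b)) (hmem a ha.1 b hb).2.continuousAt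
          (Continuous.prodMk_right a).continuousAt).norm.continuousWithinAt
      have : ProperSpace B := FiniteDimensional.proper_real B
      obtain ⟨b, hb, hmin⟩ := (isCompact_closedBall b₀ δ).exists_isMinOn ⟨b₀, hb₀⟩ hcont
      exact ⟨b, fun _ => ⟨hb, fun b' hb' => hmin hb'⟩⟩
    · exact ⟨b₀, fun h => absurd h ha⟩
  choose b hb using hex
  refine ⟨b, C, N, hN, δ, hδ0, ?_, ?_, ?_⟩
  · refine LipschitzOnWith.of_dist_le_mul fun a ha a' ha' => ?_
    rw [dist_eq_norm, dist_eq_norm]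
    exact hVC (a, b a) (hmem a ha.1 _ (hb a ha).1).1.1
      (a', b a') (hmem a' ha'.1 _ (hb a' ha').1).1.1
      (hcrit a ha _ (hb a ha).1 (hb a ha).2) (hcrit a' ha' _ (hb a' ha').1 (hb a' ha').2)
  · have ha₀ : a₀ ∈ N := mem_of_mem_nhds hN
    have h1 := (hb a₀ ha₀).2 b₀ hb₀
    have h2 := hgrow a₀ ha₀.1 _ (hb a₀ ha₀).1
    rw [h0, norm_zero] at h1
    rw [norm_le_zero_iff.1 h1, h0, sub_self, norm_zero] at h2
    have : ‖b a₀ - b₀‖ ≤ 0 := by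
      by_contra! hpos
      exact absurd h2 (not_le.2 (by positivity))
    exact sub_eq_zero.1 (norm_le_zero_iff.1 this)
  · intro a ha b' hb' hne
    by_contra! hle
    have hmin' : ∀ b'' ∈ Metric.closedBall b₀ δ, ‖ψ (a, b')‖ ≤ ‖ψ (a, b'')‖ :=
      fun b'' hb'' => hle.trans ((hb a ha).2 b'' hb'')
    have := hVC (a, b') (hmem a ha.1 _ hb').1.1 (a, b a) (hmem a ha.1 _ (hb a ha).1).1.1
      (hcrit a ha _ hb' hmin') (hcrit a ha _ (hb a ha).1 (hb a ha).2)
    simp only [sub_self, norm_zero, mul_zero, norm_le_zero_iff] at this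
    exact hne (sub_eq_zero.1 this)

end NearestPoint

/-! ### Linearization error and projection onto a manifold -/

theorem proj_eq_singleton {E : Type*} [NormedAddCommGroup E] [InnerProductSpace ℝ E] {A : Set E}
    {x p : E} (hp : p ∈ A) (h : ∀ q ∈ A, q ≠ p → dist x p < dist x q) : proj A x = {p} := by
  refine eq_singleton_iff_unique_mem.2 ⟨⟨hp, fun q hq => ?_⟩, fun q hq => ?_⟩
  · by_cases hqp : q = p
    · rw [hqp]
    · exact (h q hq hqp).le
  · by_contra hqp
    exact absurd (hq.2 p hp) (not_le.2 (h q hq.1 hqp))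

/-- The error of Newton's linearization of a `C²` map is quadratic. -/
theorem exists_norm_sub_fderiv_apply_le {E F : Type*} [NormedAddCommGroup E] [NormedSpace ℝ E]
    [NormedAddCommGroup F] [NormedSpace ℝ F] {h : E → F} (hh : ContDiffAt ℝ 2 h 0) :
    ∃ C : ℝ≥0, ∀ᶠ v in 𝓝 0, ‖h v - fderiv ℝ h v v - h 0‖ ≤ C * ‖v‖ ^ 2 := by
  have hd1 : ContDiffAt ℝ 1 (fderiv ℝ h) 0 :=
    hh.fderiv_right (m := 1) (by norm_num [one_add_one_eq_two])
  obtain ⟨K, t, ht, hK⟩ := hd1.exists_lipschitzOnWith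
  have hdiff : ∀ᶠ v in 𝓝 0, DifferentiableAt ℝ h v :=
    (hh.eventually (by simp)).mono fun q hq => hq.differentiableAt two_ne_zero
  obtain ⟨r, hr, hball⟩ := Metric.mem_nhds_iff.1 (inter_mem ht hdiff)
  -- on the ball of radius `‖v‖` the derivative differs from `Dh(v)` by at most `2 * K * ‖v‖`
  refine ⟨2 * K, ?_⟩
  filter_upwards [Metric.ball_mem_nhds 0 hr] with v hv
  have hsub : Metric.closedBall (0 : E) ‖v‖ ⊆ Metric.ball 0 r :=
    Metric.closedBall_subset_ball (by simpa using hv)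
  have hv' : v ∈ Metric.closedBall (0 : E) ‖v‖ := by simp
  have key := (convex_closedBall (0 : E) ‖v‖).norm_image_sub_le_of_norm_hasFDerivWithin_le'
    (f := h) (f' := fderiv ℝ h) (φ := fderiv ℝ h v) (C := 2 * K * ‖v‖) (x := v) (y := 0)
    (fun x hx => (hball (hsub hx)).2.hasFDerivAt.hasFDerivWithinAt) ?_ hv' (by simp)
  · rw [zero_sub, map_neg, norm_neg, ← norm_neg] at key
    calc ‖h v - fderiv ℝ h v v - h 0‖ = ‖-(h 0 - h v - -fderiv ℝ h v v)‖ := by congr 1; abel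
      _ ≤ 2 * K * ‖v‖ * ‖v‖ := key
      _ = _ := by push_cast; ring
  · intro x hx
    have h1 := hK.dist_le_mul x (hball (hsub hx)).1 v (hball hv).1
    rw [dist_eq_norm, dist_eq_norm] at h1
    have h2 : ‖x - v‖ ≤ ‖v‖ + ‖v‖ :=
      (norm_sub_le _ _).trans (by gcongr; simpa using hx)
    calc _ ≤ K * ‖x - v‖ := h1
      _ ≤ K * (‖v‖ + ‖v‖) := by gcongr
      _ = _ := by ring

/-- Projection onto a `C²` manifold `M`, given near `u` as the image of `β`, where `P` recovers the
parameter: near `u`, nearest points exist, are unique, and depend in a Lipschitz way on the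
projected point. -/
theorem exists_lipschitz_proj {U R : Type*} [NormedAddCommGroup U] [InnerProductSpace ℝ U]
    [NormedAddCommGroup R] [InnerProductSpace ℝ R] [FiniteDimensional ℝ R]
    {M : Set U} {u : U} {β : R → U} (P : U →L[ℝ] R) (hβ : ContDiffAt ℝ 2 β 0) (hβ0 : β 0 = u)
    (hM : ∀ᶠ x in 𝓝 u, x ∈ M ↔ β (P (x - u)) = x) (hP : ∀ᶠ r in 𝓝 0, P (β r - u) = r) :
    ∃ (S : U → U) (K : ℝ≥0), ∃ W ∈ 𝓝 u, LipschitzOnWith K S W ∧ S u = u ∧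
      ∀ x ∈ W, proj M x = {S x} := by
  let ψ : U × R → U := fun q => q.1 - β q.2
  have hψ : ContDiffAt ℝ 2 ψ (u, 0) :=
    contDiffAt_fst.sub (ContDiffAt.comp (g := β) (u, 0) hβ contDiffAt_snd)
  have hβd : HasFDerivAt β (fderiv ℝ β 0) 0 := (hβ.differentiableAt two_ne_zero).hasFDerivAt
  have hPβ : ∀ r, P (fderiv ℝ β 0 r) = r := by
    have e1 : HasFDerivAt (fun r => P (β r - u)) (P ∘L fderiv ℝ β 0) 0 :=
      P.hasFDerivAt.comp 0 (hβd.sub_const u)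
    have e2 : HasFDerivAt (fun r => P (β r - u)) (.id ℝ R) 0 :=
      (hasFDerivAt_id 0).congr_of_eventuallyEq hP
    exact fun r => DFunLike.congr_fun (e1.unique e2) r
  have hψd : fderiv ℝ ψ (u, 0) = .fst ℝ U R - fderiv ℝ β 0 ∘L .snd ℝ U R :=
    (hasFDerivAt_fst.sub
      (HasFDerivAt.comp (g := β) (u, 0) hβd hasFDerivAt_snd)).fderiv
  have hinj : Function.Injective (fderiv ℝ ψ (u, 0) ∘L .inr ℝ U R) := by
    rw [injective_iff_map_eq_zero]
    intro r hr
    have h1 : fderiv ℝ β 0 r = 0 := by simpa [hψd] using hr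
    rw [← hPβ r, h1, map_zero]
  obtain ⟨b, C, N, hN, δ, hδ, hbL, hb0, hbmin⟩ :=
    exists_lipschitz_minimizer hψ (by simp [ψ, hβ0]) hinj
  obtain ⟨Kβ, t, ht, hβL⟩ := (hβ.of_le one_le_two).exists_lipschitzOnWith
  have hbc : Tendsto b (𝓝 u) (𝓝 0) := by
    have := (hbL.continuousOn.continuousAt hN).tendsto
    rwa [hb0] at this
  have hβc : Tendsto β (𝓝 0) (𝓝 u) := by
    have := hβ.continuousAt.tendsto
    rwa [hβ0] at this
  have hPc : Tendsto (fun x => P (x - u)) (𝓝 u) (𝓝 0) :=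
    (P.continuous.comp (continuous_id.sub continuous_const)).tendsto' u 0 (by simp)
  obtain ⟨ρ, hρ, hball⟩ := Metric.eventually_nhds_iff_ball.1
    (hM.and (hPc.eventually (Metric.closedBall_mem_nhds (0 : R) hδ)))
  have hu : u ∈ M := hM.self_of_nhds.2 (by simp [hβ0])
  refine ⟨β ∘ b, Kβ * C, Metric.ball u (ρ / 2) ∩ (N ∩ (b ⁻¹' t ∩
    {x | β (b x) ∈ M ∧ P (β (b x) - u) = b x})), ?_, ?_, ?_, ?_⟩
  · refine inter_mem (Metric.ball_mem_nhds _ (half_pos hρ))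
      (inter_mem hN (inter_mem (hbc ht) ?_))
    filter_upwards [(hβc.comp hbc).eventually hM, hbc.eventually hP] with x h1 h2
    exact ⟨h1.2 (by simp [h2]), h2⟩
  · exact hβL.comp (hbL.mono fun x hx => hx.2.1) fun x hx => hx.2.2.1
  · simp [hb0, hβ0]
  · rintro x ⟨hxρ, hxN, -, hxM, hxP⟩
    have hxu : dist x u < ρ / 2 := hxρ
    refine proj_eq_singleton hxM fun q hq hne => ?_
    have hcase : ∀ r ∈ Metric.closedBall (0 : R) δ, r ≠ b x → dist x (β (b x)) < dist x (β r) := by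
      intro r hr hrb
      rw [dist_eq_norm, dist_eq_norm]
      exact hbmin x hxN r hr hrb
    by_cases hqρ : q ∈ Metric.ball u ρ
    · have hβq : β (P (q - u)) = q := (hball q hqρ).1.1 hq
      have := hcase (P (q - u)) (hball q hqρ).2 (fun e => hne (by rw [← hβq, e]; rfl))
      rwa [hβq] at this
    · -- points of `M` far from `u` are farther from `x` than `u` is
      have h1 : dist x (β (b x)) ≤ dist x u := by
        by_cases h0 : b x = 0
        · rw [h0, hβ0]
        · have := hcase 0 (Metric.mem_closedBall_self hδ.le) (Ne.symm h0)
          rw [hβ0] at this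
          exact this.le
      have h2 : ρ ≤ dist q u := not_lt.1 hqρ
      have h3 := dist_triangle_left q u x
      simp only [Function.comp_apply]
      linarith

/-! ### Linearized equation, active manifold and smallest elements -/

section Graph

theorem tendsto_snd_nhds_pair {U : Type*} [NormedAddCommGroup U] (u v : U) :
    Tendsto (fun p : WithLp 2 (U × U) => p.snd) (𝓝 (pair u v)) (𝓝 v) :=
  (WithLp.prod_continuous_ofLp 2 U U).snd.tendsto (pair u v)

theorem tendsto_pair {U : Type*} [NormedAddCommGroup U] {α : Type*} {l : Filter α} {f g : α → U}
    {u v : U} (hf : Tendsto f l (𝓝 u)) (hg : Tendsto g l (𝓝 v)) :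
    Tendsto (fun a => pair (f a) (g a)) l (𝓝 (pair u v)) :=
  (continuous_pair.tendsto (u, v)).comp (hf.prodMk_nhds hg)

variable {U : Type*} [NormedAddCommGroup U] [InnerProductSpace ℝ U]

theorem tangentCone_gph_eventually_eq {Φ : U → Set U} {u : U} {h : U → U}
    (hh : ContDiffAt ℝ 2 h 0)
    (hG : ∀ᶠ p in 𝓝 (pair u 0), p ∈ gph Φ ↔ p.fst = h p.snd) :
    ∀ᶠ p in 𝓝 (pair u 0), p ∈ gph Φ →
      tangentCone (gph Φ) p = {q | q.fst = fderiv ℝ h p.snd q.snd} := by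
  have hsnd := tendsto_snd_nhds_pair u 0
  have hdiff : ∀ᶠ v in 𝓝 0, DifferentiableAt ℝ h v :=
    (hh.eventually (by simp)).mono fun q hq => hq.differentiableAt two_ne_zero
  filter_upwards [hG.eventually_nhds, hsnd.eventually hdiff] with p h1 h2 h3
  exact tangentCone_eq_of_inverse_graph h1 h3 h2.hasFDerivAt

theorem projRank_eq_finrank_range {Φ : U → Set U} {p : WithLp 2 (U × U)} {h' : U →L[ℝ] U}
    (hT : tangentCone (gph Φ) p = {q | q.fst = h' q.snd}) :
    projRank Φ p = Module.finrank ℝ h'.range := by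
  have : (fun q : WithLp 2 (U × U) => q.fst) '' tangentCone (gph Φ) p = h'.range := by
    rw [hT]
    ext x
    constructor
    · rintro ⟨q, hq, rfl⟩
      exact ⟨q.snd, (show q.fst = h' q.snd from hq).symm⟩
    · rintro ⟨y, rfl⟩
      exact ⟨pair (h' y) y, rfl, rfl⟩
  rw [projRank, this, Submodule.span_eq]

/-- With the graph written as `{(h v, v)}`, the linearized equation at `(u, v)` has the explicit
solution `u - Dh(v) v`. -/
theorem mem_linearizedSolutions_iff {Φ : U → Set U} {p : WithLp 2 (U × U)} {h' : U →L[ℝ] U}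
    (hT : tangentCone (gph Φ) p = {q | q.fst = h' q.snd}) (W : Set U) (w : U) :
    w ∈ linearizedSolutions Φ W p ↔ w ∈ W ∧ w = p.fst - h' p.snd := by
  have e : pair p.fst p.snd = p := rfl
  rw [linearizedSolutions, mem_ofPred, graphicalDeriv, mem_ofPred, e, hT, mem_ofPred]
  refine and_congr_right fun _ => ?_
  change w - p.fst = h' (-p.snd) ↔ _
  rw [map_neg, sub_eq_iff_eq_add, neg_add_eq_sub]

/-- In constant-rank coordinates, the active manifold is the image of the parametrization `β`. -/
theorem eventually_mem_activeManifold_iff {Φ : U → Set U} {u : U} {M : Set U} {h : U → U}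
    {R K : Type*} [NormedAddCommGroup R] [NormedSpace ℝ R] [NormedAddCommGroup K] [NormedSpace ℝ K]
    {ψ : R × K → U} {β : R → U} (P : U →L[ℝ] R) (P' : U →L[ℝ] K)
    (hM : IsActiveManifold Φ u 0 M) (hh : ContinuousAt h 0) (hh0 : h 0 = u)
    (hG : ∀ᶠ p in 𝓝 (pair u 0), p ∈ gph Φ ↔ p.fst = h p.snd)
    (hψ : ContinuousAt ψ 0) (hψ0 : ψ 0 = 0) (hψβ : ∀ᶠ q in 𝓝 0, h (ψ q) = β q.1)
    (hinv : ∀ᶠ v in 𝓝 0, ψ (P (h v - u), P' v) = v) :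
    ∀ᶠ x in 𝓝 u, x ∈ M ↔ β (P (x - u)) = x := by
  obtain ⟨V₀, hV₀, hV⟩ := hM
  have hsnd := tendsto_snd_nhds_pair u 0
  have hPc : Tendsto (fun x => P (x - u)) (𝓝 u) (𝓝 0) :=
    (P.continuous.comp (continuous_id.sub continuous_const)).tendsto' u 0 (by simp)
  have hhc : Tendsto h (𝓝 0) (𝓝 u) := by rw [← hh0]; exact hh.tendsto
  have hq : Tendsto (fun v => (P (h v - u), P' v)) (𝓝 0) (𝓝 0) :=
    (hPc.comp hhc).prodMk_nhds (P'.continuous.tendsto' 0 0 (map_zero _))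
  have hβ : ∀ᶠ v in 𝓝 0, β (P (h v - u)) = h v := by
    filter_upwards [hinv, hq.eventually hψβ] with v h1 h2
    rw [← h2, h1]
  let V : Set (WithLp 2 (U × U)) := V₀ ∩ ({p | p ∈ gph Φ ↔ p.fst = h p.snd} ∩
    {p | β (P (h p.snd - u)) = h p.snd})
  have hVn : V ∈ 𝓝 (pair u 0) := inter_mem hV₀ (inter_mem hG (hsnd.eventually hβ))
  have hr : Tendsto (fun x => (P (x - u), (0 : K))) (𝓝 u) (𝓝 0) :=
    hPc.prodMk_nhds tendsto_const_nhds
  have hψc : Tendsto ψ (𝓝 0) (𝓝 0) := by simpa only [hψ0] using hψ.tendsto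
  filter_upwards [hV V hVn inter_subset_left, hr.eventually hψβ,
    (tendsto_pair tendsto_id (hψc.comp hr)).eventually hVn] with x h1 h2 h3
  rw [h1]
  constructor
  · rintro ⟨v, hv, hvV⟩
    have e : x = h v := hvV.2.1.1 hv
    rw [e]
    exact hvV.2.2
  · intro hx
    refine ⟨ψ (P (x - u), 0), h3.2.1.2 ?_, h3⟩
    exact (h2.trans hx).symm

/-- The smallest element of `Φ x` depends in a Lipschitz way on `x ∈ M`: in constant-rank
coordinates, `Φ x` is, near `0`, the image of `ψ (r, ·)` with `r = P (x - u)`. -/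
theorem exists_lipschitz_proj_zero {Φ : U → Set U} {u : U} {M : Set U} {h : U → U}
    {R K : Type*} [NormedAddCommGroup R] [InnerProductSpace ℝ R] [NormedAddCommGroup K]
    [InnerProductSpace ℝ K] [FiniteDimensional ℝ K]
    {ψ : R × K → U} {β : R → U} (P : U →L[ℝ] R) (P' : U →L[ℝ] K)
    (hG : ∀ᶠ p in 𝓝 (pair u 0), p ∈ gph Φ ↔ p.fst = h p.snd)
    (hψ : ContDiffAt ℝ 2 ψ 0) (hψ0 : ψ 0 = 0) (hψβ : ∀ᶠ q in 𝓝 0, h (ψ q) = β q.1)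
    (hinv : ∀ᶠ v in 𝓝 0, ψ (P (h v - u), P' v) = v)
    (hinj : Function.Injective (fderiv ℝ ψ 0 ∘L .inr ℝ R K))
    (hM : ∀ᶠ x in 𝓝 u, x ∈ M ↔ β (P (x - u)) = x) :
    ∃ (Q : U → U) (C : ℝ≥0), ∃ W ∈ 𝓝 u, LipschitzOnWith C Q W ∧ Q u = 0 ∧
      ∀ x ∈ M ∩ W, proj (Φ x) 0 = {Q x} := by
  obtain ⟨b, C, N, hN, δ, hδ, hbL, hb0, hbmin⟩ :=
    exists_lipschitz_minimizer (a₀ := (0 : R)) (b₀ := (0 : K)) hψ hψ0 hinj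
  obtain ⟨Cψ, t, ht, hψL⟩ := (hψ.of_le one_le_two).exists_lipschitzOnWith
  have hPc : Tendsto (fun x => P (x - u)) (𝓝 u) (𝓝 0) :=
    (P.continuous.comp (continuous_id.sub continuous_const)).tendsto' u 0 (by simp)
  have hbc : Tendsto b (𝓝 0) (𝓝 0) := by
    have := (hbL.continuousOn.continuousAt hN).tendsto
    rwa [hb0] at this
  have hψc : Tendsto ψ (𝓝 0) (𝓝 0) := by simpa only [hψ0] using hψ.continuousAt.tendsto
  let c : U → R × K := fun x => (P (x - u), b (P (x - u)))
  have hc : Tendsto c (𝓝 u) (𝓝 0) := hPc.prodMk_nhds (hbc.comp hPc)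
  have hcL : ∃ C' : ℝ≥0, LipschitzOnWith C' c ((fun x => P (x - u)) ⁻¹' N) := by
    have hPL : LipschitzOnWith ‖P‖₊ (fun x => P (x - u)) ((fun x => P (x - u)) ⁻¹' N) := by
      refine LipschitzOnWith.of_dist_le_mul fun x _ y _ => ?_
      rw [dist_eq_norm, ← map_sub, sub_sub_sub_cancel_right, dist_eq_norm]
      exact P.le_opNorm _
    exact ⟨_, hPL.prodMk (hbL.comp hPL fun x hx => hx)⟩
  obtain ⟨C', hcL⟩ := hcL
  have hsnd := tendsto_snd_nhds_pair u 0
  have hP' : Tendsto P' (𝓝 0) (𝓝 0) := P'.continuous.tendsto' 0 0 (map_zero _)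
  -- near `(u, 0)`, points of the graph are parametrized by `ψ`
  have hloc : ∀ᶠ p in 𝓝 (pair u 0), p ∈ gph Φ →
      p.snd = ψ (P (p.fst - u), P' p.snd) ∧ P' p.snd ∈ Metric.closedBall (0 : K) δ := by
    filter_upwards [hG, hsnd.eventually hinv,
      hsnd.eventually (hP'.eventually (Metric.closedBall_mem_nhds (0 : K) hδ))] with p h1 h2 h3 h4
    refine ⟨?_, h3⟩
    rw [h1.1 h4, h2]
  have hloc' : ∃ ρ > 0, ∀ᶠ x in 𝓝 u, ∀ v ∈ Metric.ball (0 : U) ρ, v ∈ Φ x →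
      v = ψ (P (x - u), P' v) ∧ P' v ∈ Metric.closedBall (0 : K) δ := by
    have h1 := (tendsto_pair (tendsto_fst (f := 𝓝 u) (g := 𝓝 (0 : U))) tendsto_snd).eventually hloc
    obtain ⟨pa, ha, pb, hb, hab⟩ := Filter.eventually_prod_iff.1 h1
    obtain ⟨ρ, hρ, hball⟩ := Metric.eventually_nhds_iff_ball.1 hb
    exact ⟨ρ, hρ, ha.mono fun x hx v hv hvx => hab hx (hball v hv) hvx⟩
  obtain ⟨ρ, hρ, hloc'⟩ := hloc'
  have hev : ∀ᶠ x in 𝓝 u, (x ∈ M → ψ (c x) ∈ Φ x) ∧ ψ (c x) ∈ Metric.ball (0 : U) ρ ∧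
      ∀ v ∈ Metric.ball (0 : U) ρ, v ∈ Φ x →
        v = ψ (P (x - u), P' v) ∧ P' v ∈ Metric.closedBall (0 : K) δ := by
    filter_upwards [hM, hc.eventually hψβ, (hψc.comp hc).eventually (Metric.ball_mem_nhds _ hρ),
      hloc', (tendsto_pair tendsto_id (hψc.comp hc)).eventually hG] with x h1 h2 h3 h4 h5
    refine ⟨fun hx => h5.2 ?_, h3, h4⟩
    exact (h2.trans (h1.1 hx)).symm
  refine ⟨ψ ∘ c, Cψ * C', (fun x => P (x - u)) ⁻¹' N ∩ (c ⁻¹' t ∩ {x | _}),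
    inter_mem (hPc hN) (inter_mem (hc ht) hev), ?_, ?_, ?_⟩
  · exact hψL.comp (hcL.mono inter_subset_left) fun x hx => hx.2.1
  · have : c u = 0 := by simp [c, hb0]
    simp [this, hψ0]
  · rintro x ⟨hxM, hxN, -, hx1, hx2, hx3⟩
    refine proj_eq_singleton (hx1 hxM) fun q hq hne => ?_
    simp only [dist_zero_left, Function.comp_apply]
    by_cases hqρ : q ∈ Metric.ball (0 : U) ρ
    · obtain ⟨e, hδq⟩ := hx3 q hqρ hq
      rw [e]
      exact hbmin _ hxN _ hδq fun e' => hne (by rw [e, e']; rfl)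
    · -- elements of `Φ x` outside the ball of radius `ρ` are larger than `ψ (c x)`
      have h1 : ρ ≤ ‖q‖ := by simpa using hqρ
      have h2 : ‖ψ (c x)‖ < ρ := by simpa using hx2
      exact h2.trans_le h1

end Graph

/-! ### Quadratic convergence -/

/-- A step that is locally well defined on `G` and squares the error generates, from nearby points
of `G`, quadratically convergent sequences. -/
theorem eventually_convergesQuadratically_iterate {E : Type*} [NormedAddCommGroup E]
    [InnerProductSpace ℝ E] {G : Set E} {z : E} {T : E → E} {ok : E → Prop} {C : ℝ} (hC : 0 ≤ C)
    (hT : ∀ᶠ p in 𝓝[G] z, T p ∈ G ∧ ok p ∧ ‖T p - z‖ ≤ C * ‖p - z‖ ^ 2) :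
    ∀ᶠ p in 𝓝[G] z, (∀ k, T^[k] p ∈ G ∧ ok (T^[k] p)) ∧
      ConvergesQuadratically C (fun k => T^[k] p) z := by
  obtain ⟨ρ, hρ, hball⟩ := Metric.mem_nhdsWithin_iff.1 hT
  -- within distance `r` of `z`, a step at least halves the error
  set r := min ρ (1 / (2 * (C + 1))) with hr
  have hr0 : 0 < r := lt_min hρ (by positivity)
  have hstep : ∀ p ∈ Metric.ball z r ∩ G, ‖T p - z‖ ≤ 1 / 2 * ‖p - z‖ := by
    rintro p ⟨hp, hpG⟩
    have h1 : ‖p - z‖ < r := mem_ball_iff_norm.1 hp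
    have h2 : C * ‖p - z‖ ≤ 1 / 2 :=
      calc C * ‖p - z‖ ≤ (C + 1) * (1 / (2 * (C + 1))) := by
            gcongr
            · linarith
            · exact h1.le.trans (min_le_right _ _)
        _ = 1 / 2 := by field_simp
    refine (hball ⟨Metric.ball_subset_ball (min_le_left _ _) hp, hpG⟩).2.2.trans ?_
    rw [pow_two, ← mul_assoc]
    gcongr
  filter_upwards [inter_mem (mem_nhdsWithin_of_mem_nhds (Metric.ball_mem_nhds z hr0))
    self_mem_nhdsWithin] with p hp
  have hmem : ∀ k, T^[k] p ∈ Metric.ball z r ∩ G := by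
    intro k
    induction k with
    | zero => exact hp
    | succ k ih =>
      rw [Function.iterate_succ_apply']
      refine ⟨?_, (hball ⟨Metric.ball_subset_ball (min_le_left _ _) ih.1, ih.2⟩).1⟩
      have h1 := hstep _ ih
      have h2 : ‖T^[k] p - z‖ < r := mem_ball_iff_norm.1 ih.1
      rw [mem_ball_iff_norm]
      linarith [norm_nonneg (T^[k] p - z)]
  have hprop := fun k => hball ⟨Metric.ball_subset_ball (min_le_left _ _) (hmem k).1, (hmem k).2⟩
  refine ⟨fun k => ⟨(hmem k).2, (hprop k).2.1⟩, ?_, fun k => ?_⟩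
  · have hgeo : ∀ k, ‖T^[k] p - z‖ ≤ (1 / 2) ^ k * ‖p - z‖ := by
      intro k
      induction k with
      | zero => simp
      | succ k ih =>
        rw [Function.iterate_succ_apply']
        refine (hstep _ (hmem k)).trans ?_
        rw [pow_succ', mul_assoc]
        gcongr
    refine tendsto_iff_norm_sub_tendsto_zero.2
      (squeeze_zero (fun _ => norm_nonneg _) hgeo ?_)
    simpa using (tendsto_pow_atTop_nhds_zero_of_lt_one (r := (1 / 2 : ℝ)) (by norm_num)
      (by norm_num)).mul_const ‖p - z‖
  · dsimp only
    rw [Function.iterate_succ_apply']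
    exact (hprop k).2.2

section Iteration

theorem norm_pair_le {U : Type*} [NormedAddCommGroup U] (a b : U) : ‖pair a b‖ ≤ ‖a‖ + ‖b‖ := by
  have e : pair a b = pair a 0 + pair 0 b := by
    rw [← WithLp.toLp_add, Prod.mk_add_mk, add_zero, zero_add]
  rw [e]
  exact (norm_add_le _ _).trans_eq (by simp)

variable {U : Type*} [NormedAddCommGroup U] [InnerProductSpace ℝ U]

/-- The linearized solution `w = h v - Dh(v) v` is within `O(‖v‖²)` of `u = h 0`, and Lipschitz maps
fixing the limit preserve this estimate. -/
theorem exists_quadratic_convergence {Φ : U → Set U} {u : U} {M W : Set U} {h : U → U}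
    (hh : ContDiffAt ℝ 2 h 0) (hh0 : h 0 = u)
    (hG : ∀ᶠ p in 𝓝 (pair u 0), p ∈ gph Φ ↔ p.fst = h p.snd)
    (hlin : ∀ᶠ p in 𝓝[gph Φ] (pair u 0), ∀ W,
      linearizedSolutions Φ W p = W ∩ {p.fst - fderiv ℝ h p.snd p.snd})
    (hw : Tendsto (fun p : WithLp 2 (U × U) => p.fst - fderiv ℝ h p.snd p.snd)
      (𝓝 (pair u 0)) (𝓝 u))
    (hW : W ∈ 𝓝 u) (huM : u ∈ M) {S Q : U → U} (hS : IsPrimalMap M W u S)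
    (hQ : IsDualMap Φ M W u Q) :
    ∃ C : ℝ, ∀ᶠ p in 𝓝[gph Φ] (pair u 0), ∃ x : ℕ → WithLp 2 (U × U), x 0 = p ∧
      IsActiveSetSequence Φ M W S Q x ∧ ConvergesQuadratically C x (pair u 0) := by
  obtain ⟨hSM, ⟨K₁, hS⟩, hSu⟩ := hS
  obtain ⟨hQΦ, ⟨K₂, hQ⟩, hQu⟩ := hQ
  obtain ⟨C₀, hC₀⟩ := exists_norm_sub_fderiv_apply_le hh
  have huW : u ∈ W := mem_of_mem_nhds hW
  have hsnd := tendsto_snd_nhds_pair u 0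
  have hSc : Tendsto S (𝓝 u) (𝓝 u) := by
    simpa only [hSu] using (hS.continuousOn.continuousAt hW).tendsto
  let w : WithLp 2 (U × U) → U := fun p => p.fst - fderiv ℝ h p.snd p.snd
  let T : WithLp 2 (U × U) → WithLp 2 (U × U) := fun p => pair (S (w p)) (Q (S (w p)))
  let C : ℝ≥0 := (1 + K₂) * (K₁ * C₀)
  have hT : ∀ᶠ p in 𝓝[gph Φ] (pair u 0), T p ∈ gph Φ ∧
      (linearizedSolutions Φ W p = {w p} ∧ S (w p) ∈ M ∩ W) ∧
      ‖T p - pair u 0‖ ≤ C * ‖p - pair u 0‖ ^ 2 := by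
    filter_upwards [hlin, nhdsWithin_le_nhds hG, self_mem_nhdsWithin,
      nhdsWithin_le_nhds (hw.eventually hW), nhdsWithin_le_nhds ((hSc.comp hw).eventually hW),
      nhdsWithin_le_nhds (hsnd.eventually hC₀)] with p h1 h2 h3 h4 h5 h6
    have hSw : S (w p) ∈ M ∩ W := ⟨hSM h4, h5⟩
    refine ⟨hQΦ _ hSw, ⟨?_, hSw⟩, ?_⟩
    · rw [h1]
      exact inter_eq_right.2 (singleton_subset_iff.2 h4)
    · rw [← h2.1 h3, hh0] at h6
      have e1 : ‖S (w p) - u‖ ≤ K₁ * ‖w p - u‖ := by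
        simpa only [dist_eq_norm, hSu] using hS.dist_le_mul (w p) h4 u huW
      have e2 : ‖Q (S (w p))‖ ≤ K₂ * ‖S (w p) - u‖ := by
        simpa only [dist_eq_norm, hQu, sub_zero] using
          hQ.dist_le_mul (S (w p)) hSw u ⟨huM, huW⟩
      have e3 : T p - pair u 0 = pair (S (w p) - u) (Q (S (w p))) := by
        rw [← sub_zero (Q (S (w p)))]; rfl
      calc ‖T p - pair u 0‖ ≤ ‖S (w p) - u‖ + ‖Q (S (w p))‖ := e3 ▸ norm_pair_le _ _
        _ ≤ (1 + K₂) * ‖S (w p) - u‖ := by linarith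
        _ ≤ (1 + K₂) * (K₁ * (C₀ * ‖p - pair u 0‖ ^ 2)) := by
          gcongr
          refine e1.trans ?_
          gcongr
          refine h6.trans ?_
          gcongr
          simpa using WithLp.norm_snd_le (x := p - pair u 0)
        _ = C * ‖p - pair u 0‖ ^ 2 := by simp only [C]; push_cast; ring
  refine ⟨C, ?_⟩
  filter_upwards [eventually_convergesQuadratically_iterate C.2 hT] with p hp
  refine ⟨fun k => T^[k] p, rfl, fun k => ⟨(hp.1 k).1, w (T^[k] p), (hp.1 k).2.1, (hp.1 k).2.2, ?_⟩,
    hp.2⟩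
  exact Function.iterate_succ_apply' T k p

end Iteration

end ActiveSet

theorem mainTheorem2 {U : Type*} [NormedAddCommGroup U] [InnerProductSpace ℝ U]
    [FiniteDimensional ℝ U] (Φ : U → Set U) (ubar : U) (M : Set U)
    (hzero : ActiveSet.IsIsolatedZero Φ ubar)
    (hsmooth : ActiveSet.IsPartlySmooth 2 Φ ubar 0)
    (hM : ActiveSet.IsActiveManifold Φ ubar 0 M)
    (htrans : ∀ y : U, 0 ∈ ActiveSet.coderiv Φ ubar 0 y → y = 0) :
    ∃ W₀ ∈ 𝓝 ubar, ∀ W ∈ 𝓝 ubar, W ⊆ W₀ →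
      -- primal map, and the special choice `Proj_M`
      ((∃ S : U → U, ActiveSet.IsPrimalMap M W ubar S) ∧
        ∃ S : U → U, ActiveSet.IsPrimalMap M W ubar S ∧
          ∀ u ∈ W, ActiveSet.proj M u = {S u}) ∧
      -- dual map, and the special choice `Proj_{Φ(u)}(0)`
      ((∃ Q : U → U, ActiveSet.IsDualMap Φ M W ubar Q) ∧
        ∃ Q : U → U, ActiveSet.IsDualMap Φ M W ubar Q ∧
          ∀ u ∈ M ∩ W, ActiveSet.proj (Φ u) 0 = {Q u}) ∧
      -- unique solvability of the linearized equation
      (∀ᶠ p in 𝓝[ActiveSet.gph Φ] (ActiveSet.pair ubar 0),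
        ∃! w, w ∈ ActiveSet.linearizedSolutions Φ W p) ∧
      -- quadratic convergence, for every choice of the two maps
      (∀ S Q : U → U, ActiveSet.IsPrimalMap M W ubar S → ActiveSet.IsDualMap Φ M W ubar Q →
        ∃ C : ℝ, ∀ᶠ p in 𝓝[ActiveSet.gph Φ] (ActiveSet.pair ubar 0),
          ∃ x : ℕ → WithLp 2 (U × U), x 0 = p ∧
            ActiveSet.IsActiveSetSequence Φ M W S Q x ∧
            ActiveSet.ConvergesQuadratically C x (ActiveSet.pair ubar 0)) := by
  open ActiveSet in
  obtain ⟨hman, d, hrank⟩ := hsmooth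
  obtain ⟨h, hh, hh0, hG⟩ := exists_inverse_graph hzero hman htrans
  have hT := tangentCone_gph_eventually_eq hh hG
  have hhc : Tendsto h (𝓝 0) (𝓝 ubar) := by rw [← hh0]; exact hh.continuousAt.tendsto
  have hrank' : ∀ᶠ v in 𝓝 0, Module.finrank ℝ (fderiv ℝ h v).range = d := by
    have hpair := tendsto_pair hhc (tendsto_id (x := 𝓝 (0 : U)))
    filter_upwards [hpair.eventually hG, hpair.eventually hT,
      hpair.eventually (eventually_nhdsWithin_iff.1 hrank)] with v h1 h2 h3
    have hv : pair (h v) v ∈ gph Φ := h1.2 rfl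
    exact (projRank_eq_finrank_range (h2 hv)).symm.trans (h3 hv)
  obtain ⟨R, K, ψ, β, hψ, hψ0, hβ, hβ0, hψβ, hP, hinv, hinj⟩ :=
    exists_constant_rank_chart hh one_le_two hrank'
  simp only [hh0, sub_zero] at hβ0 hP hinv
  have hMβ := eventually_mem_activeManifold_iff R.orthogonalProjectionOnto
    K.orthogonalProjectionOnto hM hh.continuousAt hh0 hG hψ.continuousAt hψ0 hψβ hinv
  obtain ⟨S, KS, W₁, hW₁, hSL, hSu, hSproj⟩ := exists_lipschitz_proj _ hβ hβ0 hMβ hP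
  obtain ⟨Q, KQ, W₂, hW₂, hQL, hQu, hQproj⟩ :=
    exists_lipschitz_proj_zero _ _ hG hψ hψ0 hψβ hinv hinj hMβ
  have hlin : ∀ᶠ p in 𝓝[gph Φ] (pair ubar 0), ∀ W,
      linearizedSolutions Φ W p = W ∩ {p.fst - fderiv ℝ h p.snd p.snd} := by
    filter_upwards [nhdsWithin_le_nhds hT, self_mem_nhdsWithin] with p h1 h2 W
    ext w
    exact mem_linearizedSolutions_iff (h1 h2) W w
  have hw : Tendsto (fun p : WithLp 2 (U × U) => p.fst - fderiv ℝ h p.snd p.snd)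
      (𝓝 (pair ubar 0)) (𝓝 ubar) := by
    have hsnd := tendsto_snd_nhds_pair ubar 0
    have hfst : Tendsto (fun p : WithLp 2 (U × U) => p.fst) (𝓝 (pair ubar 0)) (𝓝 ubar) :=
      (WithLp.fstL 2 ℝ U U).continuous.tendsto _
    have hd : Tendsto (fderiv ℝ h) (𝓝 0) (𝓝 (fderiv ℝ h 0)) :=
      (hh.fderiv_right (m := 1) (by norm_num [one_add_one_eq_two])).continuousAt
    have happ : Tendsto (fun p : WithLp 2 (U × U) => fderiv ℝ h p.snd p.snd) (𝓝 (pair ubar 0))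
        (𝓝 (fderiv ℝ h 0 0)) :=
      (isBoundedBilinearMap_apply.continuous.tendsto (fderiv ℝ h 0, (0 : U))).comp
        ((hd.comp hsnd).prodMk_nhds hsnd)
    simpa using hfst.sub happ
  have hS : ∀ W ⊆ W₁, IsPrimalMap M W ubar S := fun W hW =>
    ⟨fun x hx => ((hSproj x (hW hx)).symm ▸ mem_singleton (S x) : S x ∈ proj M x).1,
      ⟨KS, hSL.mono hW⟩, hSu⟩
  have hQ : ∀ W ⊆ W₂, IsDualMap Φ M W ubar Q := fun W hW =>
    ⟨fun x hx => ((hQproj x ⟨hx.1, hW hx.2⟩).symm ▸ mem_singleton (Q x) :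
        Q x ∈ proj (Φ x) 0).1,
      ⟨KQ, hQL.mono (inter_subset_right.trans hW)⟩, hQu⟩
  refine ⟨W₁ ∩ W₂, inter_mem hW₁ hW₂, fun W hW hWW => ?_⟩
  have hWW₁ : W ⊆ W₁ := hWW.trans inter_subset_left
  have hWW₂ : W ⊆ W₂ := hWW.trans inter_subset_right
  refine ⟨⟨⟨S, hS W hWW₁⟩, S, hS W hWW₁, fun x hx => hSproj x (hWW₁ hx)⟩,
    ⟨⟨Q, hQ W hWW₂⟩, Q, hQ W hWW₂, fun x hx => hQproj x ⟨hx.1, hWW₂ hx.2⟩⟩, ?_, ?_⟩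
  · filter_upwards [hlin, nhdsWithin_le_nhds (hw.eventually hW)] with p h1 h2
    rw [h1]
    exact ⟨_, ⟨h2, rfl⟩, fun y hy => hy.2⟩
  · have huM : ubar ∈ M := hMβ.self_of_nhds.2 (by simp [hβ0])
    exact fun S' Q' hS' hQ' =>
      exists_quadratic_convergence hh hh0 hG hlin hw hW huM hS' hQ'
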